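/- Let $b\ge 2$ be an integer, and let $\mathcal A$ be a minimal complete deterministic finite automaton over the digit alphabet $A_b=\{0,1,\dots,b-1\}$. Write $q\cdot a$ for the successor of the state $q$ by the digit $a$. Words are read least significant digit first: the value of $a_0a_1\cdots a_{n-1}$ is $\sum_{i} a_i b^i$. We say that $\mathcal A$ accepts the set of numbers $E\subseteq\mathbb N$ if a word over $A_b$ is accepted by $\mathcal A$ exactly when its value is in $E$. A set $E\subseteq\mathbb N$ is ultimately periodic if it coincides, on all large enough integers, with a set of the form $\{n\in\mathbb N : n \bmod q\in S\}$ with $q\ge1$ and $S\subseteq\{0,\dots,q-1\}$; a set of exactly this form is said to have period $q$. Then $\mathcal A$ accepts some ultimately periodic set of numbers if and only if $\mathcal A$ satisfies the UP-criterion, that is, the following five conditions. - (UP-0) For every state $q$, $q\cdot 0$ is final if and only if $q$ is final. - (UP-1) Every strongly connected component (SCC) that contains an internal transition labelled by a digit different from $0$ (a Type 1 SCC) is a leaf of the condensation of $\mathcal A$. - (UP-2) Every non-trivial SCC that is not of Type 1 (a Type 2 SCC) is a simple circuit labelled by $0$, and it has a unique successor in the condensation, which is a leaf. - (UP-3) Every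 Type 1 SCC is the quotient of a Pascal automaton $\mathcal P^R_p$, for some $p$ and $R$. - (UP-4) Every Type 2 SCC is embeddable in the unique successor given by (UP-2). Here an SCC is non-trivial if it contains an internal transition (possibly a loop on its only state). The condensation is the graph of the SCC's, with an edge from $C$ to $D$ if some transition goes from a state of $C$ to a state of $D$; loops are disregarded when speaking of successors and leaves. Let $p\ge1$ be coprime with $b$, let $R\subseteq\mathbb Z/p\mathbb Z$ be such that $p$ is the smallest period of $\{n\in\mathbb N : n \bmod p\in R\}$, and let $\psi$ be the multiplicative order of $b$ modulo $p$. The Pascal automaton $\mathcal P_p^R$ has state set $\mathbb Z/p\mathbb Z\times\mathbb Z/\psi\mathbb Z$, initial state $(0,0)$, transitions $(s,t)\cdot a=(s+a\,b^t,\,t+1)$ and set of final states $R\times\mathbb Z/\psi\mathbb Z$. An SCC $C$ is the quotient of $\mathcal P_p^R$ if there is a map $\varphi$ from the states of $\mathcal P_p^R$ onto $C$ such that $\varphi(x\cdot a)=\varphi(x)\cdot a$ for all states $x$ and digits $a$, and such that $\varphi(x)$ is final in $\mathcal A$ if and only if $x$ is final in $\mathcal P_p^R$. An SCC $C$ is embeddable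 in an SCC $D$ if there is an injective map $f:C\to D$ such that, for all $q\in C$ and $a\in A_b$: if $q\cdot a\in C$ then $f(q\cdot a)=f(q)\cdot a$, and if $q\cdot a\notin C$ then $f(q)\cdot a=q\cdot a$. -/

import Mathlib

namespace UPAut

/-! ### Sets of numbers -/

/-- `E` is a periodic set of numbers of period `q`: it is the set of the integers congruent
modulo `q` to an element of some set `S ⊆ {0, 1, …, q - 1}`. -/
def HasPeriod (E : Set ℕ) (q : ℕ) : Prop :=
  0 < q ∧ ∃ S : Set ℕ, (∀ r ∈ S, r < q) ∧ ∀ n, n ∈ E ↔ ∃ r ∈ S, n ≡ r [MOD q]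

/-- `E` is ultimately periodic: it coincides with a periodic set on all large enough integers. -/
def UltimatelyPeriodic (E : Set ℕ) : Prop :=
  ∃ (F : Set ℕ) (q : ℕ), HasPeriod F q ∧ ∃ m : ℕ, ∀ n, m < n → (n ∈ E ↔ n ∈ F)

/-- The value of a word over `{0, …, b - 1}`, least significant digit first. -/
def value {b : ℕ} (w : List (Fin b)) : ℕ :=
  Nat.ofDigits b (w.map Fin.val)

/-! ### Automata

`DFA (Fin b) σ` is the type of complete deterministic automata with state set `σ` that read words
over the digits `0, …, b - 1`. -/

section Automata

variable {b : ℕ} {σ : Type*}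

/-- `M` accepts the set of numbers `E`: its language is the set of all the representations
(that is, with any number of trailing zeros) of the elements of `E`. -/
def AcceptsNumbers (M : DFA (Fin b) σ) (E : Set ℕ) : Prop :=
  ∀ w : List (Fin b), w ∈ M.accepts ↔ value w ∈ E

/-- `M` is minimal: no complete deterministic automaton with the same language has fewer states. -/
def IsMinimal (M : DFA (Fin b) σ) : Prop :=
  ∀ (n : ℕ) (N : DFA (Fin b) (Fin n)), N.accepts = M.accepts → Nat.card σ ≤ n

/-- There is a path from the state `q` to the state `s`. -/
def Reaches (M : DFA (Fin b) σ) (q s : σ) : Prop :=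
  ∃ w : List (Fin b), M.evalFrom q w = s

/-- Strong connectivity. -/
def sccSetoid (M : DFA (Fin b) σ) : Setoid σ where
  r q s := Reaches M q s ∧ Reaches M s q
  iseqv :=
    { refl := fun q => ⟨⟨[], rfl⟩, ⟨[], rfl⟩⟩
      symm := fun h => ⟨h.2, h.1⟩
      trans := by
        rintro x y z ⟨⟨u, rfl⟩, ⟨v, hv⟩⟩ ⟨⟨u', rfl⟩, ⟨v', hv'⟩⟩
        refine ⟨⟨u ++ u', DFA.evalFrom_of_append _ _ _ _⟩, ⟨v' ++ v, ?_⟩⟩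
        rw [DFA.evalFrom_of_append, hv', hv] }

/-- The strongly connected components, i.e. the vertices of the condensation of `M`. -/
def SCC (M : DFA (Fin b) σ) : Type _ := Quotient (sccSetoid M)

/-- The strongly connected component of a state. -/
def scc (M : DFA (Fin b) σ) (q : σ) : SCC M := Quotient.mk (sccSetoid M) q

/-- The set of the states of a strongly connected component. -/
def states (M : DFA (Fin b) σ) (C : SCC M) : Set σ := {q | scc M q = C}

/-- `(C, D)` is an edge of the condensation of `M` (this may be a loop). -/
def Edge (M : DFA (Fin b) σ) (C D : SCC M) : Prop :=
  ∃ q ∈ states M C, ∃ a : Fin b, M.step q a ∈ states M D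

/-- `D` is a successor of `C` in the condensation, loops being disregarded. -/
def Successor (M : DFA (Fin b) σ) (C D : SCC M) : Prop :=
  D ≠ C ∧ Edge M C D

/-- `C` is a leaf of the condensation: no edge, except possibly a loop, leaves `C`. -/
def IsLeaf (M : DFA (Fin b) σ) (C : SCC M) : Prop :=
  ∀ D, ¬ Successor M C D

/-- `C` is non-trivial: it contains an internal transition (possibly a loop on its only state). -/
def Nontriv (M : DFA (Fin b) σ) (C : SCC M) : Prop :=
  ∃ q ∈ states M C, ∃ a : Fin b, M.step q a ∈ states M C

variable [NeZero b]

/-- Type 1: `C` contains an internal transition labelled by a digit different from `0`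
(and is thus non-trivial). -/
def IsType1 (M : DFA (Fin b) σ) (C : SCC M) : Prop :=
  ∃ q ∈ states M C, ∃ a : Fin b, a ≠ 0 ∧ M.step q a ∈ states M C

/-- Type 2: `C` is non-trivial and not of Type 1. -/
def IsType2 (M : DFA (Fin b) σ) (C : SCC M) : Prop :=
  Nontriv M C ∧ ¬ IsType1 M C

/-- `C` is a simple circuit labelled by `0`: its states are pairwise distinct states
`c 0, …, c (n - 1)` with transitions `c i → c (i + 1)` labelled by `0`, where the indices are taken
modulo `n ≥ 1`, and it has no other internal transition. -/
def IsZeroCircuit (M : DFA (Fin b) σ) (C : SCC M) : Prop :=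
  ∃ n : ℕ, 0 < n ∧ ∃ c : ZMod n → σ, Function.Injective c ∧ Set.range c = states M C ∧
    (∀ i, M.step (c i) 0 = c (i + 1)) ∧
    ∀ i (a : Fin b), M.step (c i) a ∈ states M C → a = 0

/-- The component `C` is embeddable in the component `D`. -/
def Embeddable (M : DFA (Fin b) σ) (C D : SCC M) : Prop :=
  ∃ f : σ → σ, Set.MapsTo f (states M C) (states M D) ∧ Set.InjOn f (states M C) ∧
    ∀ q ∈ states M C, ∀ a : Fin b,
      (M.step q a ∈ states M C → f (M.step q a) = M.step (f q) a) ∧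
      (M.step q a ∉ states M C → M.step (f q) a = M.step q a)

end Automata

/-! ### Pascal automata -/

/-- The (generalised) Pascal automaton: its states are the pairs
(value modulo `p`, length modulo the order `ψ` of `b` modulo `p`). -/
noncomputable def pascal (b p : ℕ) (R : Set (ZMod p)) :
    DFA (Fin b) (ZMod p × ZMod (orderOf (b : ZMod p))) where
  step x a := (x.1 + (a.val : ZMod p) * (b : ZMod p) ^ x.2.val, x.2 + 1)
  start := (0, 0)
  accept := {x | x.1 ∈ R}

/-- `p` and `R` are the parameters of a Pascal automaton in base `b`: `p` is coprime with `b`, and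
`p` is the smallest period of the set of the integers whose residue modulo `p` is in `R`. -/
def IsPascalParam (b p : ℕ) (R : Set (ZMod p)) : Prop :=
  Nat.Coprime p b ∧ IsLeast {q : ℕ | HasPeriod {n : ℕ | (n : ZMod p) ∈ R} q} p

/-- The subautomaton of `M` with state set `C` (and initial state `φ P.start ∈ C`) is a quotient of
the complete automaton `P`: there is a map `φ` from the states of `P` onto `C` that commutes with
the transitions and such that a state is final if, and only if, its image is. As `φ` is onto `C`,
the transitions of `M` out of states of `C` then stay in `C`. -/
def IsQuotientOf {b : ℕ} {σ τ : Type*} (M : DFA (Fin b) σ) (C : Set σ) (P : DFA (Fin b) τ) :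
    Prop :=
  ∃ φ : τ → σ, Set.range φ = C ∧ (∀ x a, φ (P.step x a) = M.step (φ x) a) ∧
    ∀ x, φ x ∈ M.accept ↔ x ∈ P.accept

/-! ### The UP-criterion -/

/-- The UP-criterion for a complete deterministic automaton reading base-`b` digits. -/
structure UPCriterion {b : ℕ} [NeZero b] {σ : Type*} (M : DFA (Fin b) σ) : Prop where
  /-- The successor by `0` of a final (resp. non-final) state is final (resp. non-final). -/
  up0 : ∀ q, M.step q 0 ∈ M.accept ↔ q ∈ M.accept
  /-- Every Type 1 component is a leaf of the condensation. -/
  up1 : ∀ C, IsType1 M C → IsLeaf M C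
  /-- Every Type 2 component is a `0`-circuit, and has a unique successor, which is a leaf. -/
  up2 : ∀ C, IsType2 M C → IsZeroCircuit M C ∧
    ∃ D, Successor M C D ∧ (∀ D', Successor M C D' → D' = D) ∧ IsLeaf M D
  /-- Every Type 1 component is the quotient of a Pascal automaton. -/
  up3 : ∀ C, IsType1 M C → ∃ (p : ℕ) (R : Set (ZMod p)), IsPascalParam b p R ∧
    IsQuotientOf M (states M C) (pascal b p R)
  /-- Every Type 2 component is embeddable in its unique successor. -/
  up4 : ∀ C, IsType2 M C → ∀ D, Successor M C D → Embeddable M C D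

end UPAut

namespace UPAut

/-! ### Periodic sets of numbers -/

/-! In a minimal automaton every state is reachable and is determined by the set of numbers it
recognizes (`IsMinimal.reaches_and_injective`). Reading `u` turns `E` into `{n | value u + b ^
u.length * n ∈ E}`. If `E` is ultimately periodic, a long `u` absorbs the part of the period not
prime to `b`: the new set has a fixed period `p` prime to `b`, except possibly at `0`, and even at
`0` if `value u` is large (`UltimatelyPeriodic.exists_period`).

Pumping a circuit with a nonzero digit makes both length and value large, so Type 1 states recognize
truly periodic sets. On such sets a word acts only through its value modulo `p` and its length
modulo the order of `b`. This action is invertible, whence a leaf (`Recognizes.reaches_symm`) and a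
Pascal quotient (`Recognizes.exists_pascal`). In a Type 2 component only the length grows: a state
differs at most at `0` from a state recognizing a periodic set, and sending the former to the latter
is the embedding.

Conversely, `up0` makes acceptance depend on the value alone, and `UPCriterion.ultimatelyPeriodic`
treats the states by induction: Type 1 states recognize periodic sets, Type 2 states the same up to
`0`, and a trivial component is handled through the sections modulo `b`. -/

theorem hasPeriod_iff {E : Set ℕ} {q : ℕ} :
    HasPeriod E q ↔ 0 < q ∧ ∀ m n, m ≡ n [MOD q] → (m ∈ E ↔ n ∈ E) := by
  constructor
  · rintro ⟨hq, S, -, h⟩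
    refine ⟨hq, fun m n hmn => ?_⟩
    rw [h, h]
    exact ⟨fun ⟨r, hr, h'⟩ => ⟨r, hr, hmn.symm.trans h'⟩, fun ⟨r, hr, h'⟩ => ⟨r, hr, hmn.trans h'⟩⟩
  · rintro ⟨hq, h⟩
    refine ⟨hq, {r | r < q ∧ r ∈ E}, fun r hr => hr.1, fun n => ⟨fun hn => ?_, ?_⟩⟩
    · exact ⟨n % q, ⟨Nat.mod_lt _ hq, (h _ _ (Nat.mod_modEq n q)).2 hn⟩, (Nat.mod_modEq n q).symm⟩
    · rintro ⟨r, hr, hnr⟩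
      exact (h _ _ hnr).2 hr.2

theorem hasPeriod_iff_add {E : Set ℕ} {q : ℕ} :
    HasPeriod E q ↔ 0 < q ∧ ∀ n, n + q ∈ E ↔ n ∈ E := by
  rw [hasPeriod_iff]
  refine and_congr_right fun hq => ⟨fun h n => h _ _ (by simp), fun h => ?_⟩
  have key : ∀ k n, n + q * k ∈ E ↔ n ∈ E := by
    intro k
    induction k with
    | zero => simp
    | succ k ih =>
      intro n
      rw [Nat.mul_succ, ← add_assoc, h, ih]
  intro m n hmn
  rw [← Nat.mod_add_div m q, ← Nat.mod_add_div n q, key, key, hmn]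

theorem HasPeriod.pos {E : Set ℕ} {q : ℕ} (h : HasPeriod E q) : 0 < q := h.1

theorem HasPeriod.mem_congr {E : Set ℕ} {q : ℕ} (h : HasPeriod E q) {m n : ℕ}
    (hmn : m ≡ n [MOD q]) : m ∈ E ↔ n ∈ E :=
  (hasPeriod_iff.1 h).2 m n hmn

theorem HasPeriod.affine {E : Set ℕ} {q : ℕ} (h : HasPeriod E q) (v c : ℕ) :
    HasPeriod {n | v + c * n ∈ E} q :=
  hasPeriod_iff.2 ⟨h.pos, fun _ _ hmn => h.mem_congr ((hmn.mul_left c).add_left v)⟩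

/-- The least period divides every period. -/
theorem HasPeriod.dvd_of_isLeast {E : Set ℕ} {p q : ℕ} (hp : IsLeast {q | HasPeriod E q} p)
    (hq : HasPeriod E q) : p ∣ q := by
  have hp' : HasPeriod E p := hp.1
  by_contra hd
  have hr : HasPeriod E (q % p) := by
    refine hasPeriod_iff_add.2 ⟨Nat.pos_of_ne_zero fun h => hd (Nat.dvd_of_mod_eq_zero h),
      fun n => ?_⟩
    rw [hp'.mem_congr ((Nat.mod_modEq q p).add_left n)]
    exact (hasPeriod_iff_add.1 hq).2 n
  exact absurd (hp.2 hr) (not_le.2 (Nat.mod_lt _ hp'.pos))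

theorem HasPeriod.exists_isLeast {E : Set ℕ} {q : ℕ} (hq : HasPeriod E q) :
    ∃ p, IsLeast {q | HasPeriod E q} p := by
  classical
  exact ⟨Nat.find ⟨q, hq⟩, Nat.find_spec ⟨q, hq⟩, fun _ h => Nat.find_min' ⟨q, hq⟩ h⟩

/-- Two sets of period `p` that have the same positive elements are equal. -/
theorem HasPeriod.eq_of_pos {E F : Set ℕ} {p : ℕ} (hE : HasPeriod E p) (hF : HasPeriod F p)
    (h : ∀ n, 0 < n → (n ∈ E ↔ n ∈ F)) : E = F := by
  ext n
  rw [← (hasPeriod_iff_add.1 hE).2, ← (hasPeriod_iff_add.1 hF).2]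
  exact h _ (Nat.add_pos_right _ hE.pos)

theorem UltimatelyPeriodic.congr {E F : Set ℕ} (hE : UltimatelyPeriodic E)
    (h : ∀ n, 0 < n → (n ∈ F ↔ n ∈ E)) : UltimatelyPeriodic F := by
  obtain ⟨G, q, hG, m, hm⟩ := hE
  exact ⟨G, q, hG, m, fun n hn => (h n (by omega)).trans (hm n hn)⟩

/-- A set is ultimately periodic if its sections modulo `b` are. -/
theorem ultimatelyPeriodic_of_sections {b : ℕ} (hb : 0 < b) {E : Set ℕ}
    (h : ∀ a : Fin b, UltimatelyPeriodic {n | a.val + b * n ∈ E}) : UltimatelyPeriodic E := by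
  choose F q hF m hm using h
  let Q := ∏ a, q a
  refine ⟨{n | n / b ∈ F ⟨n % b, Nat.mod_lt _ hb⟩}, b * Q, ?_, b * (∑ a, m a + 1), ?_⟩
  · refine hasPeriod_iff_add.2 ⟨Nat.mul_pos hb (Finset.prod_pos fun a _ => (hF a).pos), fun n => ?_⟩
    simp only [Set.mem_ofPred_eq, Nat.add_mul_mod_self_left, Nat.add_mul_div_left _ _ hb]
    apply (hF _).mem_congr
    have : q ⟨n % b, Nat.mod_lt _ hb⟩ ∣ Q := Finset.dvd_prod_of_mem q (Finset.mem_univ _)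
    simpa using ((Nat.modEq_zero_iff_dvd.2 this).add_left (n / b))
  · intro n hn
    have h1 := hm ⟨n % b, Nat.mod_lt _ hb⟩ (n / b) (by
      have h2 : m ⟨n % b, Nat.mod_lt _ hb⟩ ≤ ∑ a, m a :=
        Finset.single_le_sum (fun _ _ => Nat.zero_le _) (Finset.mem_univ _)
      have h3 : ∑ a, m a + 1 ≤ n / b := (Nat.le_div_iff_mul_le hb).2 (by rw [mul_comm]; exact hn.le)
      omega)
    simpa [Nat.mod_add_div] using h1

/-- Every positive integer divides the product of an integer prime to `b` and a power of `b`. -/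
theorem exists_coprime_dvd_mul_pow (b : ℕ) (q : ℕ) (hq : 0 < q) :
    ∃ p k, 0 < p ∧ Nat.Coprime p b ∧ q ∣ p * b ^ k := by
  induction q using Nat.strong_induction_on with
  | _ q ih =>
    by_cases hc : Nat.Coprime q b
    · exact ⟨q, 0, hq, hc, by simp⟩
    · have hg : 0 < q.gcd b := Nat.gcd_pos_of_pos_left _ hq
      have hg1 : 1 < q.gcd b := lt_of_le_of_ne hg (Ne.symm hc)
      -- Each division by `q.gcd b` is paid for by one factor `b`.
      obtain ⟨p, k, hp, hpb, hd⟩ := ih (q / q.gcd b) (Nat.div_lt_self hq hg1)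
        (Nat.div_pos (Nat.gcd_le_left _ hq) hg)
      refine ⟨p, k + 1, hp, hpb, ?_⟩
      rw [pow_succ, ← mul_assoc]
      have := mul_dvd_mul hd (Nat.gcd_dvd_right q b)
      rwa [Nat.div_mul_cancel (Nat.gcd_dvd_left q b)] at this

/-! ### Values of words -/

section Words

variable {b : ℕ}

@[simp]
theorem value_nil : value ([] : List (Fin b)) = 0 := rfl

@[simp]
theorem value_cons (a : Fin b) (w : List (Fin b)) : value (a :: w) = a.val + b * value w := by
  simp [value, Nat.ofDigits_cons]

theorem value_append (u v : List (Fin b)) :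
    value (u ++ v) = value u + b ^ u.length * value v := by
  simp [value, Nat.ofDigits_append]

theorem exists_word (hb : 0 < b) (L n : ℕ) (h : n < b ^ L) :
    ∃ w : List (Fin b), w.length = L ∧ value w = n := by
  induction L generalizing n with
  | zero => exact ⟨[], rfl, by simp at h; simp [h]⟩
  | succ L ih =>
    obtain ⟨w, hw, hv⟩ := ih (n / b) (Nat.div_lt_of_lt_mul (by rwa [pow_succ'] at h))
    exact ⟨⟨n % b, Nat.mod_lt _ hb⟩ :: w, by simp [hw], by simp [hv, Nat.mod_add_div]⟩

/-- There is a word of given value and of given length modulo `ψ`. -/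
theorem exists_word_modEq (hb : 2 ≤ b) {ψ : ℕ} (hψ : 0 < ψ) (n t : ℕ) :
    ∃ w : List (Fin b), value w = n ∧ w.length ≡ t [MOD ψ] := by
  -- Adding `ψ * n ≥ n` keeps the residue of the length and leaves room for `n < b ^ n`.
  obtain ⟨w, hw, hv⟩ := exists_word (b := b) (by omega) (t + ψ * n) n <| by
    calc n < b ^ n := Nat.lt_pow_self (by omega)
      _ ≤ b ^ (t + ψ * n) := Nat.pow_le_pow_right (by omega)
        (le_trans (Nat.le_mul_of_pos_left n hψ) (Nat.le_add_left _ _))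
  exact ⟨w, hv, by simp [hw, Nat.ModEq]⟩

theorem orderOf_natCast_pos {p : ℕ} (hpb : Nat.Coprime p b) : 0 < orderOf (b : ZMod p) := by
  rw [← ZMod.coe_unitOfCoprime b hpb.symm, orderOf_units]
  exact orderOf_pos _

theorem pow_modEq_pow {p : ℕ} {i j : ℕ} (h : i ≡ j [MOD orderOf (b : ZMod p)]) :
    b ^ i ≡ b ^ j [MOD p] := by
  rw [← ZMod.natCast_eq_natCast_iff]
  push_cast
  rw [← pow_mod_orderOf, h, pow_mod_orderOf]

/-- Every word can be completed into a word of value `0` modulo `p` and of length `0` modulo the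
order of `b` modulo `p`. -/
theorem exists_completion (hb : 2 ≤ b) {p : ℕ} (hp : 0 < p) (hpb : Nat.Coprime p b)
    (w : List (Fin b)) : ∃ w' : List (Fin b), value (w ++ w') ≡ 0 [MOD p] ∧
      b ^ (w ++ w').length ≡ 1 [MOD p] := by
  have : NeZero p := ⟨hp.ne'⟩
  have hψ := orderOf_natCast_pos hpb
  obtain ⟨ψ, hψ'⟩ : ∃ ψ, orderOf (b : ZMod p) = ψ + 1 := ⟨_, (Nat.succ_pred_eq_of_pos hψ).symm⟩
  let c : ZMod p := ((b ^ w.length : ℕ) : ZMod p)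
  -- The value solves `value w + c * x = 0` in `ZMod p`. As the order is `ψ + 1`, a length congruent
  -- to `ψ * w.length` brings the total to `0`.
  obtain ⟨w', hv, hl⟩ := exists_word_modEq hb hψ (-(value w : ZMod p) * c⁻¹).val (ψ * w.length)
  refine ⟨w', ?_, ?_⟩
  · rw [value_append, hv, ← ZMod.natCast_eq_natCast_iff]
    have : c * c⁻¹ = 1 := ZMod.coe_mul_inv_eq_one _ (hpb.symm.pow_left _)
    rw [Nat.cast_add, Nat.cast_mul, ZMod.natCast_zmod_val]
    change _ + c * _ = _
    linear_combination (-(value w : ZMod p)) * this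
  · have : (w ++ w').length ≡ 0 [MOD orderOf (b : ZMod p)] := by
      rw [List.length_append]
      refine (hl.add_left _).trans ?_
      rw [hψ', Nat.modEq_zero_iff_dvd]
      exact ⟨w.length, by ring⟩
    simpa using pow_modEq_pow this

end Words

section Automata

variable {b : ℕ} {σ : Type*} {M : DFA (Fin b) σ}

/-! ### Reachability and components -/

theorem Reaches.refl (q : σ) : Reaches M q q := ⟨[], rfl⟩

theorem Reaches.trans {q r s : σ} : Reaches M q r → Reaches M r s → Reaches M q s := by
  rintro ⟨u, rfl⟩ ⟨v, rfl⟩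
  exact ⟨u ++ v, DFA.evalFrom_of_append _ _ _ _⟩

theorem reaches_evalFrom (q : σ) (w : List (Fin b)) : Reaches M q (M.evalFrom q w) := ⟨w, rfl⟩

theorem reaches_step (q : σ) (a : Fin b) : Reaches M q (M.step q a) := ⟨[a], rfl⟩

theorem scc_eq_iff {q s : σ} : scc M q = scc M s ↔ Reaches M q s ∧ Reaches M s q :=
  Quotient.eq (r := sccSetoid M)

theorem mem_states {q : σ} {C : SCC M} : q ∈ states M C ↔ scc M q = C := Iff.rfl

theorem exists_scc (C : SCC M) : ∃ q, scc M q = C := Quotient.exists_rep C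

theorem isLeaf_of_reaches {q : σ} (h : ∀ s, Reaches M q s → Reaches M s q) :
    IsLeaf M (scc M q) := by
  rintro _ ⟨hne, r, hr, a, rfl⟩
  have hqr := (scc_eq_iff.1 hr).2.trans (reaches_step r a)
  exact hne (scc_eq_iff.2 ⟨h _ hqr, hqr⟩)

theorem IsLeaf.step_mem {C : SCC M} (h : IsLeaf M C) {q : σ} (hq : q ∈ states M C) (a : Fin b) :
    M.step q a ∈ states M C := by
  by_contra hn
  exact h _ ⟨hn, q, hq, a, rfl⟩

/-! ### Sets of numbers recognized from a state -/

/-- From the state `q`, the automaton accepts exactly the words whose value is in `E`. -/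
def Recognizes (M : DFA (Fin b) σ) (q : σ) (E : Set ℕ) : Prop :=
  ∀ w : List (Fin b), M.evalFrom q w ∈ M.accept ↔ value w ∈ E

theorem Recognizes.evalFrom {q : σ} {E : Set ℕ} (h : Recognizes M q E) (u : List (Fin b)) :
    Recognizes M (M.evalFrom q u) {n | value u + b ^ u.length * n ∈ E} := fun w => by
  rw [← DFA.evalFrom_of_append, h, value_append, Set.mem_ofPred_eq]

theorem Recognizes.step {q : σ} {E : Set ℕ} (h : Recognizes M q E) (a : Fin b) :
    Recognizes M (M.step q a) {n | a.val + b * n ∈ E} := by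
  simpa using h.evalFrom [a]

theorem Recognizes.mem_accept_iff {q : σ} {E : Set ℕ} (h : Recognizes M q E) :
    q ∈ M.accept ↔ 0 ∈ E := h []

theorem exists_value (hb : 2 ≤ b) (n : ℕ) : ∃ w : List (Fin b), value w = n :=
  (exists_word_modEq hb one_pos n 0).imp fun _ h => h.1

theorem exists_recognizes {q : σ} (h : ∀ u v : List (Fin b), value u = value v →
    M.evalFrom q u ∈ M.accept → M.evalFrom q v ∈ M.accept) : ∃ E, Recognizes M q E :=
  ⟨{n | ∃ w : List (Fin b), value w = n ∧ M.evalFrom q w ∈ M.accept},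
    fun w => ⟨fun hw => ⟨w, rfl, hw⟩, fun ⟨u, hu, hu'⟩ => h u w hu hu'⟩⟩

/-! ### Pascal automata -/

theorem pascal_step {p : ℕ} (R : Set (ZMod p)) (s : ZMod p) (k : ℕ) (a : Fin b) :
    (pascal b p R).step (s, (k : ZMod (orderOf (b : ZMod p)))) a =
      (s + (a.val : ZMod p) * (b : ZMod p) ^ k, ((k + 1 : ℕ) : ZMod (orderOf (b : ZMod p)))) := by
  simp only [pascal, ZMod.val_natCast, pow_mod_orderOf, Nat.cast_add, Nat.cast_one]

theorem pascal_evalFrom {p : ℕ} (R : Set (ZMod p)) (s : ZMod p) (k : ℕ) (w : List (Fin b)) :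
    (pascal b p R).evalFrom (s, (k : ZMod (orderOf (b : ZMod p)))) w =
      (s + (value w : ZMod p) * (b : ZMod p) ^ k,
        ((k + w.length : ℕ) : ZMod (orderOf (b : ZMod p)))) := by
  induction w generalizing s k with
  | nil => simp
  | cons a w ih =>
    rw [DFA.evalFrom_cons, pascal_step, ih, value_cons, List.length_cons]
    rw [Nat.add_right_comm k 1, add_assoc k _ 1]
    refine Prod.ext ?_ rfl
    push_cast
    ring

theorem IsQuotientOf.evalFrom {τ : Type*} {P : DFA (Fin b) τ} {φ : τ → σ}
    (h : ∀ x a, φ (P.step x a) = M.step (φ x) a) (x : τ) (w : List (Fin b)) :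
    φ (P.evalFrom x w) = M.evalFrom (φ x) w := by
  induction w generalizing x with
  | nil => rfl
  | cons a w ih => rw [DFA.evalFrom_cons, DFA.evalFrom_cons, ih, h]

/-- The states of a quotient of a Pascal automaton recognize periodic sets. -/
theorem IsQuotientOf.hasPeriod (hb : 2 ≤ b) {C : Set σ} {p : ℕ} {R : Set (ZMod p)}
    (hp : IsPascalParam b p R) (hC : IsQuotientOf M C (pascal b p R)) {q : σ} (hq : q ∈ C)
    {E : Set ℕ} (hE : Recognizes M q E) : HasPeriod E p := by
  obtain ⟨φ, rfl, hφ, hacc⟩ := hC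
  obtain ⟨⟨s, t⟩, rfl⟩ := hq
  have : NeZero (orderOf (b : ZMod p)) := ⟨(orderOf_natCast_pos hp.1).ne'⟩
  obtain ⟨k, rfl⟩ := ZMod.natCast_zmod_surjective t
  have key : ∀ n, n ∈ E ↔ s + (n : ZMod p) * (b : ZMod p) ^ k ∈ R := by
    intro n
    obtain ⟨w, rfl⟩ := exists_value hb n
    rw [← hE, ← IsQuotientOf.evalFrom hφ, hacc, pascal_evalFrom]
    rfl
  refine hasPeriod_iff.2 ⟨hp.2.1.1, fun m n hmn => ?_⟩
  rw [key, key, (ZMod.natCast_eq_natCast_iff _ _ _).2 hmn]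

/-! ### Automata satisfying the UP-criterion -/

variable [NeZero b]

theorem evalFrom_mem_accept_of_value_eq_zero (h0 : ∀ q, M.step q 0 ∈ M.accept ↔ q ∈ M.accept)
    (w : List (Fin b)) (hw : value w = 0) (q : σ) :
    M.evalFrom q w ∈ M.accept ↔ q ∈ M.accept := by
  induction w generalizing q with
  | nil => rfl
  | cons a w ih =>
    rw [value_cons, Nat.add_eq_zero_iff, mul_eq_zero, or_iff_right (NeZero.ne b)] at hw
    have ha : a = 0 := Fin.ext hw.1
    rw [DFA.evalFrom_cons, ih hw.2, ha, h0]

/-- Words of equal value differ only by trailing zeros, which do not affect acceptance. -/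
theorem evalFrom_mem_accept_congr (h0 : ∀ q, M.step q 0 ∈ M.accept ↔ q ∈ M.accept)
    (u v : List (Fin b)) (huv : value u = value v) (q : σ) :
    M.evalFrom q u ∈ M.accept ↔ M.evalFrom q v ∈ M.accept := by
  induction u generalizing v q with
  | nil => exact (evalFrom_mem_accept_of_value_eq_zero h0 v huv.symm q).symm
  | cons a u ih =>
    cases v with
    | nil => exact evalFrom_mem_accept_of_value_eq_zero h0 _ huv q
    | cons a' v =>
      rw [value_cons, value_cons] at huv
      have ha : a = a' := Fin.ext <| by
        have := congrArg (· % b) huv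
        simpa [Nat.mod_eq_of_lt] using this
      subst ha
      exact ih v (Nat.eq_of_mul_eq_mul_left (NeZero.pos b) (Nat.add_left_cancel huv)) _

theorem UPCriterion.exists_recognizes (h : UPCriterion M) (q : σ) :
    ∃ E, Recognizes M q E :=
  UPAut.exists_recognizes fun u v huv => (evalFrom_mem_accept_congr h.up0 u v huv q).1

/-- By completeness the digit `1` can be read, and it cannot leave a leaf. -/
theorem IsLeaf.isType1 (hb : 2 ≤ b) {C : SCC M} (h : IsLeaf M C) : IsType1 M C := by
  obtain ⟨q, hq⟩ := exists_scc C
  refine ⟨q, hq, ⟨1, hb⟩, fun h1 => ?_, h.step_mem hq _⟩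
  simpa using congrArg Fin.val h1

theorem UPCriterion.ultimatelyPeriodic_of_isType1 (hb : 2 ≤ b) (h : UPCriterion M) {q : σ}
    (hq : IsType1 M (scc M q)) {E : Set ℕ} (hE : Recognizes M q E) : UltimatelyPeriodic E := by
  obtain ⟨p, R, hp, hC⟩ := h.up3 _ hq
  exact ⟨E, p, hC.hasPeriod hb hp rfl hE, 0, fun _ _ => Iff.rfl⟩

/-- Inside `C` only zeros are read, so a word of nonzero value must leave `C`; at that transition
the two paths merge. -/
theorem Embeddable.evalFrom_eq {C : SCC M} (hC : IsZeroCircuit M C) {f : σ → σ}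
    (hf : ∀ q ∈ states M C, ∀ a : Fin b,
      (M.step q a ∈ states M C → f (M.step q a) = M.step (f q) a) ∧
      (M.step q a ∉ states M C → M.step (f q) a = M.step q a))
    (w : List (Fin b)) (hw : value w ≠ 0) (q : σ) (hq : q ∈ states M C) :
    M.evalFrom q w = M.evalFrom (f q) w := by
  induction w generalizing q with
  | nil => exact absurd rfl hw
  | cons a w ih =>
    rw [DFA.evalFrom_cons, DFA.evalFrom_cons]
    by_cases ha : M.step q a ∈ states M C
    · rw [← (hf q hq a).1 ha]
      refine ih (fun hw' => hw ?_) _ ha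
      obtain ⟨n, -, c, -, hr, -, hc⟩ := hC
      obtain ⟨i, rfl⟩ := hr.symm ▸ hq
      rw [hc i a ha, value_cons, hw']
      rfl
    · rw [(hf q hq a).2 ha]

theorem UPCriterion.ultimatelyPeriodic [Finite σ] (hb : 2 ≤ b) (h : UPCriterion M) (q : σ)
    (E : Set ℕ) (hE : Recognizes M q E) : UltimatelyPeriodic E := by
  induction hn : {s | Reaches M q s}.ncard using Nat.strong_induction_on generalizing q E with
  | _ n ih =>
    by_cases h1 : IsType1 M (scc M q)
    · exact h.ultimatelyPeriodic_of_isType1 hb h1 hE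
    by_cases hnt : Nontriv M (scc M q)
    · obtain ⟨hC, D, hD, -, hleaf⟩ := h.up2 _ ⟨hnt, h1⟩
      obtain ⟨f, hfD, -, hf⟩ := h.up4 _ ⟨hnt, h1⟩ D hD
      have hfq : scc M (f q) = D := hfD rfl
      obtain ⟨F, hF⟩ := h.exists_recognizes (f q)
      refine (h.ultimatelyPeriodic_of_isType1 hb (hfq ▸ hleaf.isType1 hb) hF).congr fun n hn => ?_
      obtain ⟨w, rfl⟩ := exists_value hb n
      rw [← hE, ← hF, Embeddable.evalFrom_eq hC hf w hn.ne' q rfl]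
    · refine ultimatelyPeriodic_of_sections (by omega : 0 < b) fun a => ?_
      refine ih _ ?_ (M.step q a) _ (hE.step a) rfl
      rw [← hn]
      -- If the successor could reach `q` again, the component would be non-trivial.
      refine Set.ncard_lt_ncard ⟨fun s hs => (reaches_step q a).trans hs, fun hsub => hnt ?_⟩
      exact ⟨q, rfl, a, scc_eq_iff.2 ⟨hsub (Reaches.refl q), reaches_step q a⟩⟩

end Automata

section Minimal

variable {b : ℕ} {σ : Type*} {M : DFA (Fin b) σ}

/-! ### Minimal automata -/

/-- Comparison with the automaton of left quotients: one word per quotient gives distinct states of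
`M`, and by minimality these are all the states. -/
theorem IsMinimal.reaches_and_injective [Finite σ] (hM : IsMinimal M) :
    (∀ q, Reaches M M.start q) ∧ Function.Injective M.acceptsFrom := by
  have hreg : M.accepts.IsRegular := by
    have := Fintype.ofFinite σ
    exact Language.isRegular_iff.2 ⟨σ, this, M, rfl⟩
  have hfin : Finite (Set.range M.accepts.leftQuotient) := hreg.finite_range_leftQuotient
  have hcard : Nat.card σ ≤ Nat.card (Set.range M.accepts.leftQuotient) :=
    hM _ (DFA.reindex (Finite.equivFin _) M.accepts.toDFA)
      (by rw [DFA.accepts_reindex, Language.accepts_toDFA])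
  choose x hx using fun L : Set.range M.accepts.leftQuotient => L.2
  have hg : ∀ L, M.acceptsFrom (M.eval (x L)) = L.1 := fun L => by
    rw [← Language.leftQuotient_accepts_apply, hx L]
  have hinj : Function.Injective fun L => M.eval (x L) := fun L L' h => by
    refine Subtype.ext ?_
    rw [← hg L, ← hg L']
    exact congrArg M.acceptsFrom h
  have hsurj := (hinj.bijective_of_nat_card_le hcard).2
  refine ⟨fun q => ?_, fun q q' h => ?_⟩
  · obtain ⟨L, rfl⟩ := hsurj q
    exact reaches_evalFrom _ _
  · obtain ⟨L, rfl⟩ := hsurj q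
    obtain ⟨L', rfl⟩ := hsurj q'
    simp only [hg] at h
    rw [Subtype.ext h]

theorem Recognizes.eq_of_injective (hM : Function.Injective M.acceptsFrom) {q q' : σ} {E : Set ℕ}
    (h : Recognizes M q E) (h' : Recognizes M q' E) : q = q' :=
  hM (Set.ext fun w => (h w).trans (h' w).symm)

theorem Recognizes.unique (hb : 2 ≤ b) {q : σ} {E F : Set ℕ} (h : Recognizes M q E)
    (h' : Recognizes M q F) : E = F := by
  ext n
  obtain ⟨w, rfl⟩ := exists_value hb n
  rw [← h, ← h']

/-! ### States recognizing sets that are periodic of a period prime to the base -/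

/-- The completed word acts as the identity on sets of period `p`. Words extending `w` have value at
least `value w`, so agreement of `E` and `G` from there on suffices. -/
theorem Recognizes.exists_return (hb : 2 ≤ b) {q : σ} {E G : Set ℕ} {p : ℕ}
    (hE : Recognizes M q E) (hG : HasPeriod G p) (hpb : Nat.Coprime p b) (w : List (Fin b))
    (hEG : ∀ n, value w ≤ n → (n ∈ E ↔ n ∈ G)) :
    ∃ z, Recognizes M z G ∧ Reaches M (M.evalFrom q w) z := by
  obtain ⟨w', hv, hl⟩ := exists_completion hb hG.pos hpb w
  refine ⟨M.evalFrom q (w ++ w'), ?_, w', (DFA.evalFrom_of_append _ _ _ _).symm⟩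
  convert hE.evalFrom (w ++ w') using 1
  ext n
  rw [Set.mem_ofPred_eq, hEG _ (by rw [value_append]; omega)]
  exact hG.mem_congr (by simpa using (hv.add (hl.mul_right n)).symm)

theorem Recognizes.reaches_symm (hM : Function.Injective M.acceptsFrom) (hb : 2 ≤ b) {q : σ}
    {G : Set ℕ} {p : ℕ} (hG : Recognizes M q G) (hp : HasPeriod G p) (hpb : Nat.Coprime p b)
    (s : σ) (hs : Reaches M q s) : Reaches M s q := by
  obtain ⟨w, rfl⟩ := hs
  obtain ⟨z, hz, h⟩ := hG.exists_return hb hp hpb w fun _ _ => Iff.rfl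
  obtain rfl := hG.eq_of_injective hM hz
  exact h

/-- The component of a state that recognizes a set of period prime to `b` is a quotient of a Pascal
automaton. -/
theorem Recognizes.exists_pascal (hM : Function.Injective M.acceptsFrom) (hb : 2 ≤ b) {q : σ}
    {G : Set ℕ} {p : ℕ} (hG : Recognizes M q G) (hp : HasPeriod G p) (hpb : Nat.Coprime p b) :
    ∃ (p : ℕ) (R : Set (ZMod p)), IsPascalParam b p R ∧
      IsQuotientOf M (states M (scc M q)) (pascal b p R) := by
  have hback := hG.reaches_symm hM hb hp hpb
  obtain ⟨p', hp'⟩ := hp.exists_isLeast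
  replace hpb : Nat.Coprime p' b := hpb.coprime_dvd_left (hp.dvd_of_isLeast hp')
  have hper : HasPeriod G p' := hp'.1
  have : NeZero p' := ⟨hper.pos.ne'⟩
  have hψ : 0 < orderOf (b : ZMod p') := orderOf_natCast_pos hpb
  have : NeZero (orderOf (b : ZMod p')) := ⟨hψ.ne'⟩
  have hR : {n : ℕ | (n : ZMod p') ∈ {s : ZMod p' | s.val ∈ G}} = G := by
    ext n
    simpa [ZMod.val_natCast] using hper.mem_congr (Nat.mod_modEq n p')
  -- The state reached from `q` depends only on the Pascal state reached from `(0, 0)`; `W x` below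
  -- is a word leading to `x`.
  have key : ∀ u v : List (Fin b), (value u : ZMod p') = value v →
      (u.length : ZMod (orderOf (b : ZMod p'))) = v.length → M.evalFrom q u = M.evalFrom q v := by
    intro u v hv hl
    rw [ZMod.natCast_eq_natCast_iff] at hv hl
    refine (hG.evalFrom u).eq_of_injective hM ?_
    convert hG.evalFrom v using 1
    ext n
    exact hper.mem_congr (hv.add ((pow_modEq_pow hl).mul_right n))
  choose W hWv hWl using fun x : ZMod p' × ZMod (orderOf (b : ZMod p')) =>
    exists_word_modEq hb hψ x.1.val x.2.val
  have hWl' : ∀ x, ((W x).length : ZMod (orderOf (b : ZMod p'))) = x.2 := fun x => by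
    rw [(ZMod.natCast_eq_natCast_iff _ _ _).2 (hWl x), ZMod.natCast_zmod_val]
  have hWv' : ∀ x, (value (W x) : ZMod p') = x.1 := fun x => by
    rw [hWv, ZMod.natCast_zmod_val]
  refine ⟨p', {s | s.val ∈ G}, ⟨hpb, by rwa [hR]⟩, fun x => M.evalFrom q (W x), ?_, ?_, ?_⟩
  · refine Set.Subset.antisymm ?_ fun r hr => ?_
    · rintro _ ⟨x, rfl⟩
      exact scc_eq_iff.2 ⟨hback _ (reaches_evalFrom _ _), reaches_evalFrom _ _⟩
    · obtain ⟨w, rfl⟩ := (scc_eq_iff.1 hr).2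
      exact ⟨(value w, w.length), key _ _ (hWv' _) (hWl' _)⟩
  · intro x a
    rw [← DFA.evalFrom_append_singleton]
    refine key _ _ ?_ ?_
    · have h := (ZMod.natCast_eq_natCast_iff _ _ _).2 (pow_modEq_pow (hWl x))
      rw [hWv', value_append, Nat.cast_add, Nat.cast_mul, h, hWv']
      simp [pascal, mul_comm]
    · rw [hWl']
      simp [pascal, hWl']
  · intro x
    change _ ↔ x.1.val ∈ G
    rw [hG, hWv]

/-- The sets recognized after long words coincide with periodic sets, except possibly at `0`. -/
theorem UltimatelyPeriodic.exists_period (hb : 2 ≤ b) {E : Set ℕ} (hE : UltimatelyPeriodic E) :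
    ∃ p, Nat.Coprime p b ∧ ∃ N, ∀ u : List (Fin b), N ≤ u.length → ∃ G, HasPeriod G p ∧
      ∀ n, 0 < n ∨ N ≤ value u → (value u + b ^ u.length * n ∈ E ↔ n ∈ G) := by
  obtain ⟨F, q, hF, m, hm⟩ := hE
  obtain ⟨p, k, hp, hpb, hd⟩ := exists_coprime_dvd_mul_pow b q hF.pos
  -- Length at least `k` makes `q` divide `b ^ u.length * p`; the bound `m + 1` pushes the argument
  -- past the threshold `m`.
  refine ⟨p, hpb, max k (m + 1), fun u hu => ⟨{n | value u + b ^ u.length * n ∈ F}, ?_, ?_⟩⟩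
  · refine hasPeriod_iff_add.2 ⟨hp, fun n => hF.mem_congr ?_⟩
    have : q ∣ b ^ u.length * p := by
      rw [mul_comm]
      exact hd.trans (mul_dvd_mul_left _ (pow_dvd_pow _ (le_trans (le_max_left _ _) hu)))
    rw [mul_add]
    simpa using ((Nat.modEq_zero_iff_dvd.2 this).add_left (b ^ u.length * n)).add_left (value u)
  · refine fun n hn => hm _ ?_
    have hm1 := le_max_right k (m + 1)
    rcases hn with hn | hn
    · have h1 : u.length < b ^ u.length := Nat.lt_pow_self (by omega)
      have h2 : b ^ u.length ≤ b ^ u.length * n := Nat.le_mul_of_pos_right _ hn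
      omega
    · omega

theorem evalFrom_replicate (q : σ) (a : Fin b) (n : ℕ) :
    M.evalFrom q (List.replicate n a) = (M.step · a)^[n] q := by
  induction n generalizing q with
  | zero => rfl
  | succ n ih => rw [List.replicate_succ, DFA.evalFrom_cons, ih, Function.iterate_succ_apply]

variable [NeZero b]

/-! ### Components of Type 1 -/

/-- Each turn of a circuit beginning with a nonzero digit increases both the length and the value.
-/
theorem IsType1.exists_long_word (hb : 2 ≤ b) (hr : ∀ q, Reaches M M.start q) {C : SCC M}
    (hC : IsType1 M C) : ∃ q, scc M q = C ∧
      ∀ j, ∃ u : List (Fin b), M.eval u = q ∧ j ≤ u.length ∧ j ≤ value u := by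
  obtain ⟨q, hq, a, ha, hqa⟩ := hC
  obtain ⟨v, hv⟩ := (scc_eq_iff.1 (hqa.trans hq.symm)).1
  refine ⟨q, hq, fun j => ?_⟩
  induction j with
  | zero => exact (hr q).imp fun u hu => ⟨hu, Nat.zero_le _, Nat.zero_le _⟩
  | succ j ih =>
    obtain ⟨u, hu, hl, hvu⟩ := ih
    have ha' : 0 < a.val := Nat.pos_of_ne_zero fun h => ha (Fin.ext h)
    have : 0 < b ^ u.length * (a.val + b * value v) := by positivity
    refine ⟨u ++ a :: v, ?_, ?_, ?_⟩
    · rw [DFA.eval, DFA.evalFrom_of_append, ← DFA.eval, hu, DFA.evalFrom_cons, hv]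
    · simp; omega
    · rw [value_append, value_cons]
      omega

/-! ### Components of Type 2 -/

theorem IsType2.eq_zero {C : SCC M} (hC : IsType2 M C) {q : σ} (hq : scc M q = C) {a : Fin b}
    (ha : scc M (M.step q a) = C) : a = 0 :=
  by_contra fun h => hC.2 ⟨q, hq, a, h, ha⟩

theorem IsType2.evalFrom_eq {C : SCC M} (hC : IsType2 M C) (w : List (Fin b)) {q : σ}
    (hq : scc M q = C) (hw : scc M (M.evalFrom q w) = C) : w = List.replicate w.length 0 := by
  induction w generalizing q with
  | nil => rfl
  | cons a w ih =>
    rw [DFA.evalFrom_cons] at hw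
    have h1 : scc M (M.step q a) = C := by
      refine Eq.trans (scc_eq_iff.2 ⟨?_, reaches_step q a⟩) hq
      exact (reaches_evalFrom _ w).trans (scc_eq_iff.1 (hw.trans hq.symm)).1
    obtain rfl := hC.eq_zero hq h1
    rw [List.length_cons, List.replicate_succ, ← ih h1 hw]

theorem IsType2.step_zero {C : SCC M} (hC : IsType2 M C) {q : σ} (hq : scc M q = C) :
    scc M (M.step q 0) = C := by
  obtain ⟨r, hr, a, hra⟩ := hC.1
  obtain ⟨w, hw⟩ := (scc_eq_iff.1 (hq.trans hr.symm)).1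
  -- A nonempty word from `q` that ends in `C` consists of zeros, hence begins with `0`.
  have hwa : M.evalFrom q (w ++ [a]) = M.step r a := by
    rw [DFA.evalFrom_append_singleton, hw]
  have h0 := hC.evalFrom_eq (w ++ [a]) hq (by rw [hwa]; exact hra)
  rw [h0, List.length_append, List.length_singleton, List.replicate_succ, DFA.evalFrom_cons] at hwa
  refine Eq.trans (scc_eq_iff.2 ⟨?_, reaches_step q 0⟩) hq
  exact (hwa ▸ reaches_evalFrom _ _ : Reaches M _ (M.step r a)).trans
    (scc_eq_iff.1 (hra.trans hq.symm)).1

theorem IsType2.exists_loop {C : SCC M} (hC : IsType2 M C) {q : σ} (hq : scc M q = C) :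
    ∃ n, M.evalFrom q (List.replicate (n + 1) 0) = q := by
  have h0 := hC.step_zero hq
  obtain ⟨v, hv⟩ := (scc_eq_iff.1 (h0.trans hq.symm)).1
  refine ⟨v.length, ?_⟩
  rw [List.replicate_succ, DFA.evalFrom_cons, ← hC.evalFrom_eq v h0 (by rw [hv, hq]), hv]

theorem IsType2.exists_long_word (hr : ∀ q, Reaches M M.start q) {C : SCC M}
    (hC : IsType2 M C) {q : σ} (hq : scc M q = C) (j : ℕ) :
    ∃ u : List (Fin b), M.eval u = q ∧ j ≤ u.length := by
  obtain ⟨n, hn⟩ := hC.exists_loop hq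
  induction j with
  | zero => exact (hr q).imp fun u hu => ⟨hu, Nat.zero_le _⟩
  | succ j ih =>
    obtain ⟨u, hu, hl⟩ := ih
    refine ⟨u ++ List.replicate (n + 1) 0, ?_, by simp; omega⟩
    rw [DFA.eval, DFA.evalFrom_of_append, ← DFA.eval, hu, hn]

theorem IsType2.isZeroCircuit {C : SCC M} (hC : IsType2 M C) : IsZeroCircuit M C := by
  obtain ⟨q, hq⟩ := exists_scc C
  obtain ⟨m, hm⟩ := hC.exists_loop hq
  rw [evalFrom_replicate] at hm
  let g : σ → σ := (M.step · 0)
  have hpos : 0 < Function.minimalPeriod g q :=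
    Function.minimalPeriod_pos_of_mem_periodicPts ⟨m + 1, Nat.succ_pos m, hm⟩
  have : NeZero (Function.minimalPeriod g q) := ⟨hpos.ne'⟩
  let c : ZMod (Function.minimalPeriod g q) → σ := fun i => g^[i.val] q
  have hc : ∀ k : ℕ, c k = g^[k] q := fun k => by
    simp only [c, ZMod.val_natCast, Function.iterate_mod_minimalPeriod_eq]
  have hmem : ∀ k : ℕ, scc M (g^[k] q) = C := by
    intro k
    induction k with
    | zero => exact hq
    | succ k ih =>
      rw [Function.iterate_succ_apply']
      exact hC.step_zero ih
  refine ⟨_, hpos, c, ?_, ?_, ?_, ?_⟩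
  · intro i j hij
    exact ZMod.val_injective _ <|
      (Function.iterate_eq_iterate_iff_of_lt_minimalPeriod (ZMod.val_lt i) (ZMod.val_lt j)).1 hij
  · refine Set.Subset.antisymm ?_ fun r hr => ?_
    · rintro _ ⟨i, rfl⟩
      exact hmem _
    · obtain ⟨w, rfl⟩ := (scc_eq_iff.1 (hq.trans (mem_states.1 hr).symm)).1
      refine ⟨w.length, ?_⟩
      rw [hc, hC.evalFrom_eq w hq hr, evalFrom_replicate, List.length_replicate]
  · intro i
    obtain ⟨k, rfl⟩ := ZMod.natCast_zmod_surjective i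
    rw [← Nat.cast_succ, hc, hc, Function.iterate_succ_apply']
  · exact fun i a ha => hC.eq_zero (hmem _) ha

theorem value_replicate_zero (n : ℕ) : value (List.replicate n (0 : Fin b)) = 0 := by
  induction n with
  | zero => rfl
  | succ n ih => simp [List.replicate_succ, ih]

/-- If a state `q` of a Type 2 component recognizes a set that coincides outside `0` with the
set of period prime to `b` recognized by a state `z`, then the component of `z` is the unique
successor of the component of `q`. -/
theorem IsType2.successor_iff (hM : Function.Injective M.acceptsFrom) (hb : 2 ≤ b) {q z : σ}
    (hC : IsType2 M (scc M q)) {E G : Set ℕ} {p : ℕ} (hE : Recognizes M q E)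
    (hG : Recognizes M z G) (hp : HasPeriod G p) (hpb : Nat.Coprime p b)
    (hEG : ∀ n, 0 < n → (n ∈ E ↔ n ∈ G)) (D : SCC M) :
    Successor M (scc M q) D ↔ D = scc M z := by
  have key : ∀ r, scc M r = scc M q → ∀ a : Fin b, a ≠ 0 → scc M (M.step r a) = scc M z := by
    intro r hr a ha
    obtain ⟨w, rfl⟩ := (scc_eq_iff.1 hr).2
    rw [hC.evalFrom_eq w rfl hr, ← DFA.evalFrom_append_singleton]
    generalize hu : List.replicate w.length 0 ++ [a] = u
    have hpos : 0 < value u := by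
      have : 0 < a.val := Nat.pos_of_ne_zero fun h => ha (Fin.ext h)
      rw [← hu, value_append, value_cons]
      positivity
    obtain ⟨z', hz', h⟩ := hE.exists_return hb hp hpb u fun n hn => hEG n (by omega)
    rw [hz'.eq_of_injective hM hG] at h
    have hu' : Recognizes M (M.evalFrom q u) {n | value u + b ^ u.length * n ∈ G} := by
      convert hE.evalFrom u using 1
      ext n
      exact (hEG _ (by omega)).symm
    -- The state after `u` recognizes a section of `G`, again of period `p`, so whatever it reaches
    -- leads back to it.
    exact scc_eq_iff.2 ⟨h, hu'.reaches_symm hM hb (hp.affine _ _) hpb _ h⟩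
  have h1 : (⟨1, hb⟩ : Fin b) ≠ 0 := fun h => by simpa using congrArg Fin.val h
  constructor
  · rintro ⟨hne, r, hr, a, rfl⟩
    refine key r hr a ?_
    rintro rfl
    exact hne (hC.step_zero hr)
  · rintro rfl
    -- Were the two components equal, the digit `1` would label an internal transition.
    refine ⟨fun h => h1 (hC.eq_zero (q := q) rfl ?_), q, rfl, ⟨1, hb⟩, key q rfl _ h1⟩
    rw [key q rfl _ h1, h]

/-! ### The automaton of an ultimately periodic set -/

theorem IsMinimal.upCriterion [Finite σ] (hb : 2 ≤ b) (hM : IsMinimal M) {E : Set ℕ}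
    (hE : UltimatelyPeriodic E) (hME : AcceptsNumbers M E) : UPCriterion M := by
  obtain ⟨hr, hinj⟩ := hM.reaches_and_injective
  have hstart : Recognizes M M.start E := hME
  obtain ⟨p, hpb, N, hN⟩ := hE.exists_period hb
  have hex : ∀ q, ∃ E, Recognizes M q E := fun q => by
    obtain ⟨u, rfl⟩ := hr q
    exact ⟨_, hstart.evalFrom u⟩
  have up0 : ∀ q, M.step q 0 ∈ M.accept ↔ q ∈ M.accept := fun q => by
    obtain ⟨F, hF⟩ := hex q
    rw [hF.mem_accept_iff, (hF.step 0).mem_accept_iff]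
    simp
  have type1 : ∀ C, IsType1 M C → ∃ q G, scc M q = C ∧ Recognizes M q G ∧ HasPeriod G p := by
    intro C hC
    obtain ⟨q, hq, h⟩ := hC.exists_long_word hb hr
    obtain ⟨u, rfl, hl, hv⟩ := h N
    obtain ⟨G, hG, hEG⟩ := hN u hl
    refine ⟨_, G, hq, ?_, hG⟩
    change Recognizes M (M.evalFrom M.start u) G
    convert hstart.evalFrom u using 1
    ext n
    exact (hEG n (Or.inr hv)).symm
  have type2 : ∀ C, IsType2 M C → ∀ q ∈ states M C, ∃ z E G, Recognizes M q E ∧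
      Recognizes M z G ∧ HasPeriod G p ∧ ∀ n, 0 < n → (n ∈ E ↔ n ∈ G) := by
    intro C hC q hq
    obtain ⟨u, rfl, hl⟩ := hC.exists_long_word hr hq N
    obtain ⟨G, hG, hEG⟩ := hN u hl
    have h1 : 0 < value [(⟨1, hb⟩ : Fin b)] := by simp
    -- Reading the digit `1` skips the exceptional number `0`.
    obtain ⟨z, hz, -⟩ := (hstart.evalFrom u).exists_return hb hG hpb [⟨1, hb⟩]
      fun n hn => hEG n (Or.inl (h1.trans_le hn))
    exact ⟨z, _, G, hstart.evalFrom u, hz, hG, fun n hn => hEG n (Or.inl hn)⟩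
  refine ⟨up0, ?_, ?_, ?_, ?_⟩
  · intro C hC
    obtain ⟨q, G, rfl, hG, hp⟩ := type1 C hC
    exact isLeaf_of_reaches (hG.reaches_symm hinj hb hp hpb)
  · intro C hC
    refine ⟨hC.isZeroCircuit, ?_⟩
    obtain ⟨q, rfl⟩ := exists_scc C
    obtain ⟨z, F, G, hF, hG, hp, hFG⟩ := type2 _ hC q rfl
    have hs := hC.successor_iff hinj hb hF hG hp hpb hFG
    exact ⟨scc M z, (hs _).2 rfl, fun D' => (hs D').1,
      isLeaf_of_reaches (hG.reaches_symm hinj hb hp hpb)⟩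
  · intro C hC
    obtain ⟨q, G, rfl, hG, hp⟩ := type1 C hC
    exact hG.exists_pascal hinj hb hp hpb
  · intro C hC D hD
    choose! f F G hF hG hp hFG using type2 C hC
    refine ⟨f, ?_, ?_, ?_⟩
    · rintro q rfl
      exact ((hC.successor_iff hinj hb (hF q rfl) (hG q rfl) (hp q rfl) hpb (hFG q rfl) D).1
        hD).symm
    -- With equal images, the two sets can differ only at `0`, that is, in finality, which is
    -- constant along a `0`-circuit.
    · intro q hq r hr hqr
      have hGG : G q = G r := (hG q hq).unique hb (hqr ▸ hG r hr)
      have hacc : r ∈ M.accept ↔ q ∈ M.accept := by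
        obtain ⟨w, rfl⟩ := (scc_eq_iff.1 (hq.trans hr.symm)).1
        refine evalFrom_mem_accept_of_value_eq_zero up0 w ?_ q
        rw [hC.evalFrom_eq w hq hr, value_replicate_zero]
      refine (hF q hq).eq_of_injective hinj ?_
      convert hF r hr using 1
      ext n
      rcases Nat.eq_zero_or_pos n with rfl | hn
      · rw [← (hF q hq).mem_accept_iff, ← (hF r hr).mem_accept_iff, hacc]
      · rw [hFG q hq n hn, hFG r hr n hn, hGG]
    · intro q hq a
      constructor
      · intro ha
        refine (hG _ ha).eq_of_injective hinj ?_
        convert (hG q hq).step a using 1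
        -- Both sets have period `p`, so the unknown behaviour at `0` is irrelevant.
        refine (hp _ ha).eq_of_pos ((hp q hq).affine _ _) fun n hn => ?_
        rw [← hFG _ ha n hn, (hF _ ha).unique hb ((hF q hq).step a)]
        exact hFG q hq _ (by positivity)
      · intro ha
        have ha0 : 0 < a.val := Nat.pos_of_ne_zero fun h => by
          obtain rfl : a = 0 := Fin.ext h
          exact ha (hC.step_zero hq)
        refine ((hG q hq).step a).eq_of_injective hinj ?_
        convert (hF q hq).step a using 1
        ext n
        exact (hFG q hq _ (by omega)).symm

end Minimal

end UPAut

theorem theoremt (b : ℕ) [NeZero b] (hb : 2 ≤ b) {σ : Type*} [Finite σ]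
    (M : DFA (Fin b) σ) (hM : UPAut.IsMinimal M) :
    (∃ E : Set ℕ, UPAut.UltimatelyPeriodic E ∧ UPAut.AcceptsNumbers M E) ↔
      UPAut.UPCriterion M := by
  constructor
  · rintro ⟨E, hE, hME⟩
    exact hM.upCriterion hb hE hME
  · intro h
    obtain ⟨E, hE⟩ := h.exists_recognizes M.start
    exact ⟨E, h.ultimatelyPeriodic hb _ E hE, hE⟩
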